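/- Let $\mathfrak g$ be a finite-dimensional semisimple Lie algebra over $\mathbb C$ with Killing form $B$, let $\mathfrak h\subset\mathfrak g$ be a Cartan subalgebra with root system $R\subset\mathfrak h^*$ and root spaces $\mathfrak g^\alpha$, and let $R_+\subset R$ be a choice of positive roots. For each $\alpha\in R_+$ choose non-zero $e_\alpha\in\mathfrak g^{\alpha}$ and $f_\alpha\in\mathfrak g^{-\alpha}$, and put $$\pi=\sum_{\alpha\in R_+}\frac{1}{B(e_\alpha,f_\alpha)}\,e_\alpha\wedge f_\alpha\in\textstyle\bigwedge^2_{\mathbb C}\mathfrak g .$$ Let $\mathfrak g_{\mathbb R}$ be $\mathfrak g$ viewed as a real Lie algebra, and let $\pi_{\mathbb R}\in\bigwedge^2_{\mathbb R}\mathfrak g_{\mathbb R}$ be the real bivector underlying $\pi$: the image of $\pi$ under the real linear map $\bigwedge^2_{\mathbb C}\mathfrak g\to\bigwedge^2_{\mathbb R}\mathfrak g_{\mathbb R}$, $x\wedge y\mapsto x\wedge y-ix\wedge iy$ (so that $\pi_{\mathbb R}(\operatorname{Re}\xi,\operatorname{Re}\eta)=\operatorname{Re}\pi(\xi,\eta)$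 for all $\xi,\eta\in\mathfrak g^*$). For a bivector $t$ on a Lie algebra, $[X,t]$ denotes the adjoint action of $X$, $t^\sharp$ the contraction of covectors with $t$, and $[t,\bullet]$ the cobracket $X\mapsto[t,X]=-[X,t]$. Dualizing a cobracket gives a bracket on the dual space. A Lie subalgebra of a Lie bialgebra is coisotropic if its annihilator is a Lie subalgebra of the dual Lie algebra. Then $(\mathfrak g,[\pi,\bullet])$ is a complex Lie bialgebra and $(\mathfrak g_{\mathbb R},[\pi_{\mathbb R},\bullet])$ is a real Lie bialgebra. Moreover, let $\beta\in R_+$ be such that for every $\alpha\in R$ the set $(\alpha+\mathbb Z\beta)\cap R$ does not contain three consecutive elements $\gamma,\gamma+\beta,\gamma+2\beta$. Then for $X=e_\beta$ and for $X=f_\beta$ the following holds: 1. $[X,\pi_{\mathbb R}]^\sharp\,\mathfrak g_{\mathbb R}^*$ is a coisotropic subalgebra of the real Lie bialgebra $\mathfrak g_{\mathbb R}$; 2. the complexification of $[X,\pi_{\mathbb R}]^\sharp\,\mathfrak g_{\mathbb R}^*$, that is its complex linear span in $\mathfrak g$, is a coisotropic subalgebra of the complex Lie bialgebra $\mathfrak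 g$. -/

import Mathlib

open scoped TensorProduct

noncomputable section

namespace CoisotropicSubalgebras

/-! ### Bivectors and Lie bialgebras

`∧² L` is realized inside `L ⊗ L` as the antisymmetric tensors, with `x ∧ y = x ⊗ y - y ⊗ x`.
The adjoint action `[X, t]` of `X : L` on `t : L ⊗ L` is Mathlib's `⁅X, t⁆`, which satisfies
`⁅X, x ⊗ y⁆ = ⁅X, x⁆ ⊗ y + x ⊗ ⁅X, y⁆`. -/

section General

variable (K : Type*) [Field K] {L : Type*} [LieRing L] [LieAlgebra K L]

/-- The bivector `x ∧ y`. -/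
def wedge (x y : L) : L ⊗[K] L := x ⊗ₜ[K] y - y ⊗ₜ[K] x

variable {K}

/-- The map `t^♯ : L^* → L` given by contraction with `t`: `(x ⊗ y)^♯ ξ = ξ(x) y`. -/
def sharp (t : L ⊗[K] L) : Module.Dual K L →ₗ[K] L where
  toFun ξ := TensorProduct.lid K L (LinearMap.rTensor L ξ t)
  map_add' ξ η := by simp [LinearMap.rTensor_add]
  map_smul' c ξ := by simp [LinearMap.rTensor_smul]

/-- The cobracket `δ = [t, •]` defined by a bivector `t`, that is `δ(X) = [t, X] = -[X, t]`. -/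
def cobracket (t : L ⊗[K] L) : L →ₗ[K] L ⊗[K] L where
  toFun X := -⁅X, t⁆
  map_add' X Y := by simp [add_lie, add_comm]
  map_smul' c X := by simp [smul_lie]

/-- The bracket on `L^*` obtained by dualizing `δ`: `[ξ, η]_*(X) = ⟨ξ ⊗ η, δ(X)⟩`. -/
def dualBracket (δ : L →ₗ[K] L ⊗[K] L) (ξ η : Module.Dual K L) : Module.Dual K L :=
  TensorProduct.dualDistrib K L L (ξ ⊗ₜ[K] η) ∘ₗ δ

/-- `(L, δ)` is a Lie bialgebra: `δ` takes values in the antisymmetric tensors, the dual bracket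
on `L^*` satisfies the Jacobi identity, and `δ` is a derivation of the bracket of `L`, i.e.
`δ([X, Y]) = [δ(X), Y] + [X, δ(Y)]`. -/
structure IsLieBialgebra (δ : L →ₗ[K] L ⊗[K] L) : Prop where
  skew : ∀ X, TensorProduct.comm K L L (δ X) = -δ X
  jacobi : ∀ ξ η ζ : Module.Dual K L,
    dualBracket δ ξ (dualBracket δ η ζ) + dualBracket δ η (dualBracket δ ζ ξ)
      + dualBracket δ ζ (dualBracket δ ξ η) = 0
  cocycle : ∀ X Y, δ ⁅X, Y⁆ = ⁅X, δ Y⁆ - ⁅Y, δ X⁆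

/-- The subspace `V` of `(L, δ)` is a coisotropic subalgebra: it is a Lie subalgebra of `L`, and
its annihilator is a Lie subalgebra of `L^*`. -/
structure IsCoisotropicSubalgebra (δ : L →ₗ[K] L ⊗[K] L) (V : Submodule K L) : Prop where
  lie_mem : ∀ x ∈ V, ∀ y ∈ V, ⁅x, y⁆ ∈ V
  annihilator_lie_mem : ∀ ξ ∈ V.dualAnnihilator, ∀ η ∈ V.dualAnnihilator,
    dualBracket δ ξ η ∈ V.dualAnnihilator

end General

/-! ### The underlying real Lie algebra

The underlying real vector space of `g` is Mathlib's `Module.complexToReal`. -/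

section Realification

variable {g : Type*} [LieRing g] [LieAlgebra ℂ g]

/-- A complex Lie algebra viewed as a real Lie algebra. -/
instance realLieAlgebra : LieAlgebra ℝ g where
  __ := Module.complexToReal g
  lie_smul r x y := by
    change ⁅x, (r : ℂ) • y⁆ = (r : ℂ) • ⁅x, y⁆
    exact lie_smul _ _ _

/-- Auxiliary real bilinear map `(x, y) ↦ x ⊗ y - ix ⊗ iy`. -/
def realBivectorAux : g →ₗ[ℝ] g →ₗ[ℝ] g ⊗[ℝ] g :=
  LinearMap.mk₂ ℝ (fun x y => x ⊗ₜ[ℝ] y - (Complex.I • x) ⊗ₜ[ℝ] (Complex.I • y))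
    (fun x x' y => by simp only [smul_add, TensorProduct.add_tmul]; abel)
    (fun r x y => by
      rw [smul_comm Complex.I r x, ← TensorProduct.smul_tmul', ← TensorProduct.smul_tmul',
        smul_sub])
    (fun x y y' => by simp only [smul_add, TensorProduct.tmul_add]; abel)
    (fun r x y => by
      rw [smul_comm Complex.I r y, TensorProduct.tmul_smul, TensorProduct.tmul_smul, smul_sub])

theorem realBivectorAux_smul (c : ℂ) (x y : g) :
    realBivectorAux (c • x) y = realBivectorAux x (c • y) := by
  have hI : ∀ x y : g, realBivectorAux (Complex.I • x) y = realBivectorAux x (Complex.I • y) := by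
    intro x y
    simp only [realBivectorAux, LinearMap.mk₂_apply, smul_smul, Complex.I_mul_I, neg_smul,
      one_smul, TensorProduct.neg_tmul, TensorProduct.tmul_neg]
    abel
  have hc : ∀ z : g, c • z = c.re • z + c.im • (Complex.I • z) := by
    intro z
    conv_lhs => rw [← Complex.re_add_im c, add_smul, mul_smul]
    rfl
  rw [hc x, hc y, map_add, map_add, LinearMap.add_apply, LinearMap.map_smul realBivectorAux,
    LinearMap.map_smul realBivectorAux, LinearMap.smul_apply, LinearMap.smul_apply, hI,
    LinearMap.map_smul (realBivectorAux x), LinearMap.map_smul (realBivectorAux x)]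

/-- The real bivector (real part) underlying a complex bivector: the additive map
`g ⊗_ℂ g → g ⊗_ℝ g` with `x ⊗ y ↦ x ⊗ y - ix ⊗ iy`, hence
`x ∧ y ↦ x ∧ y - ix ∧ iy`. By `dualDistrib_realBivector` it is the real tensor determined by
`⟨Re ξ ⊗ Re η, t_ℝ⟩ = Re ⟨ξ ⊗ η, t⟩` for complex linear `ξ, η`; every real linear functional
on `g` is `Re ξ` for exactly one complex linear `ξ`. -/
def realBivector : g ⊗[ℂ] g →+ g ⊗[ℝ] g :=
  TensorProduct.liftAddHom
    (AddMonoidHom.mk' (fun x => (realBivectorAux x).toAddMonoidHom) fun x x' => by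
      ext y; simp)
    (fun c x y => realBivectorAux_smul c x y)

theorem realBivector_tmul (x y : g) :
    realBivector (x ⊗ₜ[ℂ] y) = x ⊗ₜ[ℝ] y - (Complex.I • x) ⊗ₜ[ℝ] (Complex.I • y) := rfl

/-- The real linear functional `Re ξ`. -/
def rePart (ξ : Module.Dual ℂ g) : Module.Dual ℝ g :=
  Complex.reLm ∘ₗ ξ.restrictScalars ℝ

theorem dualDistrib_realBivector (ξ η : Module.Dual ℂ g) (t : g ⊗[ℂ] g) :
    TensorProduct.dualDistrib ℝ g g (rePart ξ ⊗ₜ[ℝ] rePart η) (realBivector t)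
      = (TensorProduct.dualDistrib ℂ g g (ξ ⊗ₜ[ℂ] η) t).re := by
  induction t with
  | zero => simp
  | tmul x y => simp [realBivector_tmul, rePart]
  | add s t hs ht => simp [hs, ht]

end Realification

/-! ### Roots and the standard bivector -/

section Roots

variable {g : Type*} [LieRing g] [LieAlgebra ℂ g]
  (H : LieSubalgebra ℂ g) [H.IsCartanSubalgebra]

/-- `α ∈ H^*` is a root. -/
def IsRoot (α : Module.Dual ℂ H) : Prop :=
  α ≠ 0 ∧ LieAlgebra.rootSpace H (α : H → ℂ) ≠ ⊥

/-- `P` is a choice of positive roots: the set of roots is the disjoint union of `P` and `-P`, and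
a sum of two elements of `P` which is a root lies in `P`. -/
structure IsPositiveSystem (P : Finset (Module.Dual ℂ H)) : Prop where
  isRoot : ∀ α ∈ P, IsRoot H α
  mem_or_neg_mem : ∀ α, IsRoot H α → α ∈ P ∨ -α ∈ P
  neg_notMem : ∀ α ∈ P, -α ∉ P
  add_mem : ∀ α ∈ P, ∀ β ∈ P, IsRoot H (α + β) → α + β ∈ P

/-- For every root `α`, the set `(α + ℤβ) ∩ R` does not contain three consecutive elements. -/
def NoThreeString (β : Module.Dual ℂ H) : Prop :=
  ∀ α, IsRoot H α → ¬ ∃ k : ℤ,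
    IsRoot H (α + k • β) ∧ IsRoot H (α + (k + 1) • β) ∧ IsRoot H (α + (k + 2) • β)

variable {H}

/-- The bivector `π = ∑_{α ∈ P} B(e_α, f_α)⁻¹ e_α ∧ f_α`, with `B` the Killing form of `g`. -/
def standardBivector (P : Finset (Module.Dual ℂ H)) (e f : Module.Dual ℂ H → g) : g ⊗[ℂ] g :=
  ∑ α ∈ P, (killingForm ℂ g (e α) (f α))⁻¹ • wedge ℂ (e α) (f α)

end Roots

end CoisotropicSubalgebras

end

/-!
Identify a Lie algebra `L` with `L^*` by an invariant nondegenerate form `B`. An antisymmetric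
tensor `t` becomes a skew-adjoint operator `R` (`Represents`), `[X, t]` becomes `[ad X, R]`, and the
dual bracket becomes `-([Rx, y] + [x, Ry])`. If `R` satisfies the modified Yang-Baxter equation
`[Rx, Ry] - R([Rx, y] + [x, Ry]) = c [x, y]`, this bracket satisfies the Jacobi identity, whence a
Lie bialgebra (`Represents.isLieBialgebra`).

Put `D = [ad X, R]`. Its kernel corresponds to the annihilator of its image. Differentiating the
equation along the derivation `ad X` gives
`[Dx, Ry] + [Rx, Dy] - D([Rx, y] + [x, Ry]) = R([Dx, y] + [x, Dy])`, so that `ker D` is closed under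
the dual bracket. If `[ad X, D] = 0`, a second differentiation gives
`[Dx, Dy] = D([Dx, y] + [x, Dy])`, so that `im D` is a subalgebra
(`Represents.isCoisotropicSubalgebra`).

For the standard bivector and the Killing form, `R` is `-1` on positive root spaces, `1` on negative
ones and `0` on the Cartan subalgebra (`standardOperator_eq_smul`), and the modified Yang-Baxter
equation with `c = -1` follows from the axioms of a positive system. On the root space of `γ`,
`[ad X, D]` is a second difference of the signs of `γ`, `γ + β`, `γ + 2β` times `(ad X)²`; this
vanishes when there are no three consecutive roots in the direction of `β`
(`second_commutator_standardOperator`).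

The real bivector is represented by the same operator `R` with respect to the real part of the
Killing form (`Represents.realBivector`), so the general results apply over both fields, and the
image of `[X, π_ℝ]^♯` equals that of `[X, π]^♯`; in particular it is already a complex subspace.
-/

open scoped TensorProduct

noncomputable section

namespace CoisotropicSubalgebras

/-! ### Contraction with a tensor -/

section General

variable {K : Type*} [Field K] {L : Type*} [LieRing L] [LieAlgebra K L]

theorem dualDistrib_tmul_eq_sharp (ξ η : Module.Dual K L) (t : L ⊗[K] L) :
    TensorProduct.dualDistrib K L L (ξ ⊗ₜ[K] η) t = η (sharp t ξ) := by
  induction t with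
  | zero => simp [sharp]
  | tmul x y => simp [sharp]
  | add s t hs ht => simp_all [sharp]

theorem dualDistrib_tmul_comm (ξ η : Module.Dual K L) (t : L ⊗[K] L) :
    TensorProduct.dualDistrib K L L (ξ ⊗ₜ[K] η) (TensorProduct.comm K L L t)
      = TensorProduct.dualDistrib K L L (η ⊗ₜ[K] ξ) t := by
  induction t with
  | zero => simp
  | tmul x y => simp [mul_comm]
  | add s t hs ht => simp_all

theorem comm_lie (X : L) (t : L ⊗[K] L) :
    TensorProduct.comm K L L ⁅X, t⁆ = ⁅X, TensorProduct.comm K L L t⁆ := by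
  induction t with
  | zero => simp
  | tmul x y => simp [TensorProduct.LieModule.lie_tmul_right, add_comm]
  | add s t hs ht => simp_all

theorem sharp_lie (X : L) (t : L ⊗[K] L) (ξ : Module.Dual K L) :
    sharp ⁅X, t⁆ ξ = ⁅X, sharp t ξ⁆ + sharp t (ξ ∘ₗ LieAlgebra.ad K L X) := by
  induction t with
  | zero => simp [sharp]
  | tmul x y =>
    simp [sharp, TensorProduct.LieModule.lie_tmul_right, add_comm]
  | add s t hs ht =>
    have h (s t : L ⊗[K] L) (ξ) : sharp (s + t) ξ = sharp s ξ + sharp t ξ := by simp [sharp]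
    simp only [lie_add, h, hs, ht]
    abel

/-! ### The modified Yang-Baxter equation -/

/-- The modified classical Yang-Baxter equation
`[Rx, Ry] - R([Rx, y] + [x, Ry]) = c [x, y]`. -/
def ModifiedYangBaxter (R : L →ₗ[K] L) (c : K) : Prop :=
  ∀ x y, ⁅R x, R y⁆ - R (⁅R x, y⁆ + ⁅x, R y⁆) = c • ⁅x, y⁆

namespace ModifiedYangBaxter

variable {R : L →ₗ[K] L} {c : K} (hR : ModifiedYangBaxter R c)
include hR

/-- The bracket `[Rx, y] + [x, Ry]` satisfies the Jacobi identity. -/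
theorem jacobi (x y z : L) :
    (⁅R x, ⁅R y, z⁆ + ⁅y, R z⁆⁆ + ⁅x, R (⁅R y, z⁆ + ⁅y, R z⁆)⁆)
      + (⁅R y, ⁅R z, x⁆ + ⁅z, R x⁆⁆ + ⁅y, R (⁅R z, x⁆ + ⁅z, R x⁆)⁆)
      + (⁅R z, ⁅R x, y⁆ + ⁅x, R y⁆⁆ + ⁅z, R (⁅R x, y⁆ + ⁅x, R y⁆)⁆) = 0 := by
  have h (x y : L) : R (⁅R x, y⁆ + ⁅x, R y⁆) = ⁅R x, R y⁆ - c • ⁅x, y⁆ := by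
    rw [← hR x y]; abel
  simp only [h, lie_add, lie_sub, lie_smul]
  -- The terms without `c` cancel by the Jacobi identity for two of `Rx, Ry, Rz` and one of `x, y, z`.
  have J1 := lie_jacobi (R x) (R y) z
  have J2 := lie_jacobi (R y) (R z) x
  have J3 := lie_jacobi (R z) (R x) y
  have J4 := lie_jacobi x y z
  have h4 : c • ⁅x, ⁅y, z⁆⁆ + c • ⁅y, ⁅z, x⁆⁆ + c • ⁅z, ⁅x, y⁆⁆ = 0 := by
    rw [← smul_add, ← smul_add, J4, smul_zero]
  linear_combination (norm := module) J1 + J2 + J3 - h4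

/-- Differentiating the modified Yang-Baxter equation along a derivation `a`;
here `D` is the commutator `[a, R]`. -/
theorem derivative {a D : L →ₗ[K] L} (ha : ∀ x y, a ⁅x, y⁆ = ⁅a x, y⁆ + ⁅x, a y⁆)
    (hD : ∀ x, D x = a (R x) - R (a x)) (x y : L) :
    ⁅D x, R y⁆ + ⁅R x, D y⁆ - D (⁅R x, y⁆ + ⁅x, R y⁆) - R (⁅D x, y⁆ + ⁅x, D y⁆) = 0 := by
  have h0 := congrArg a (hR x y)
  have h1 := hR (a x) y
  have h2 := hR x (a y)
  simp only [hD, map_add, map_sub, map_smul, ha, sub_lie, lie_sub, smul_add] at *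
  linear_combination (norm := module) h0 - h1 - h2

/-- If moreover `[a, [a, R]] = 0`, the image of `D = [a, R]` is closed under brackets; the identity
below is half the second derivative of the modified Yang-Baxter equation. -/
theorem lie_commutator [CharZero K] {a D : L →ₗ[K] L}
    (ha : ∀ x y, a ⁅x, y⁆ = ⁅a x, y⁆ + ⁅x, a y⁆)
    (hD : ∀ x, D x = a (R x) - R (a x)) (hE : ∀ x, a (D x) = D (a x)) (x y : L) :
    ⁅D x, D y⁆ = D (⁅D x, y⁆ + ⁅x, D y⁆) := by
  have haR (x : L) : a (R x) = D x + R (a x) := by rw [hD]; abel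
  have h0 := congrArg a (hR.derivative ha hD x y)
  have h1 := hR.derivative ha hD (a x) y
  have h2 := hR.derivative ha hD x (a y)
  simp only [map_add, map_sub, ha, hE, haR, add_lie, lie_add, map_zero] at *
  have h3 : (2 : K) • (⁅D x, D y⁆ - (D ⁅D x, y⁆ + D ⁅x, D y⁆)) = 0 := by
    linear_combination (norm := module) h0 - h1 - h2
  exact sub_eq_zero.mp ((smul_eq_zero.mp h3).resolve_left two_ne_zero)

end ModifiedYangBaxter

/-! ### Tensors as operators -/

/-- The antisymmetric tensor `t` corresponds to the operator `R = t^♯ ∘ B`, where `L` is identified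
with `L^*` by the invariant symmetric form `B`. Nondegeneracy of `B` is stated as surjectivity of
`L → L^*`, from which injectivity follows by symmetry. -/
structure Represents (B : L →ₗ[K] Module.Dual K L) (t : L ⊗[K] L) (R : L →ₗ[K] L) : Prop where
  symm : ∀ x y, B x y = B y x
  invariant : ∀ x y z, B ⁅x, y⁆ z = B x ⁅y, z⁆
  surjective : Function.Surjective B
  skew : TensorProduct.comm K L L t = -t
  sharp_eq : ∀ x, sharp t (B x) = R x

namespace Represents

variable {B : L →ₗ[K] Module.Dual K L} {t : L ⊗[K] L} {R : L →ₗ[K] L} (h : Represents B t R)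
include h

/-- The operator of an antisymmetric tensor is skew-adjoint. -/
theorem apply_apply (x y : L) : B y (R x) = -B (R y) x := by
  rw [h.symm (R y), ← h.sharp_eq, ← h.sharp_eq, ← dualDistrib_tmul_eq_sharp,
    ← dualDistrib_tmul_eq_sharp, ← dualDistrib_tmul_comm, h.skew, map_neg]

theorem apply_lie (x y z : L) : B x ⁅y, z⁆ = -B ⁅y, x⁆ z := by
  rw [← h.invariant, ← lie_skew, map_neg, LinearMap.neg_apply]

theorem injective : Function.Injective B := by
  rw [← LinearMap.ker_eq_bot, LinearMap.ker_eq_bot']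
  intro x hx
  rw [← Module.forall_dual_apply_eq_zero_iff K]
  intro φ
  obtain ⟨y, rfl⟩ := h.surjective φ
  rw [h.symm, hx, LinearMap.zero_apply]

/-- The tensor `[X, t]` corresponds to the operator `[ad X, R]`. -/
theorem sharp_lie (X x : L) : sharp ⁅X, t⁆ (B x) = ⁅X, R x⁆ - R ⁅X, x⁆ := by
  have : B x ∘ₗ LieAlgebra.ad K L X = -B ⁅X, x⁆ := by
    ext z
    simp [h.apply_lie]
  rw [CoisotropicSubalgebras.sharp_lie, this, map_neg, h.sharp_eq, h.sharp_eq, sub_eq_add_neg]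

/-- Transported to `L` by `B`, the dual bracket is `-([Rx, y] + [x, Ry])`. -/
theorem dualBracket (x y : L) :
    dualBracket (cobracket t) (B x) (B y) = B (-(⁅R x, y⁆ + ⁅x, R y⁆)) := by
  ext Z
  have h1 : CoisotropicSubalgebras.dualBracket (cobracket t) (B x) (B y) Z
      = -B y (⁅Z, R x⁆ - R ⁅Z, x⁆) := by
    rw [← h.sharp_lie, ← dualDistrib_tmul_eq_sharp, ← map_neg]
    rfl
  have h2 : B y ⁅Z, R x⁆ = B ⁅R x, y⁆ Z := by
    rw [← lie_skew Z, map_neg, h.apply_lie, neg_neg]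
  have h3 : B (R y) ⁅Z, x⁆ = B ⁅x, R y⁆ Z := by
    rw [← lie_skew Z, map_neg, h.apply_lie, neg_neg]
  rw [h1, map_sub, h.apply_apply, h2, h3, map_neg, map_add, LinearMap.neg_apply,
    LinearMap.add_apply, sub_neg_eq_add]

theorem isLieBialgebra {c : K} (hR : ModifiedYangBaxter R c) :
    IsLieBialgebra (cobracket t) where
  skew X := by simp [cobracket, comm_lie, h.skew]
  jacobi ξ η ζ := by
    obtain ⟨x, rfl⟩ := h.surjective ξ
    obtain ⟨y, rfl⟩ := h.surjective η
    obtain ⟨z, rfl⟩ := h.surjective ζ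
    have := hR.jacobi x y z
    simp only [h.dualBracket, ← map_add]
    rw [← map_zero B, ← this]
    congr 1
    simp only [map_neg, lie_neg]
    abel
  cocycle X Y := by
    simp only [cobracket, LinearMap.coe_mk, AddHom.coe_mk, lie_lie, lie_neg]
    abel

/-- If `[ad X, [ad X, R]] = 0`, the image of `[X, t]^♯`, which is that of `[ad X, R]`, is a
coisotropic subalgebra. Since `[ad X, R]` is skew-adjoint, the annihilator of its image is its
kernel. The bracket `-([Rx, y] + [x, Ry])` preserves this kernel
because of the derivative of the modified Yang-Baxter equation along `ad X`; the second derivative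
shows that the image is a subalgebra. -/
theorem isCoisotropicSubalgebra [CharZero K] {c : K} (hR : ModifiedYangBaxter R c) (X : L)
    (hX : ∀ x, ⁅X, ⁅X, R x⁆⁆ - (2 : K) • ⁅X, R ⁅X, x⁆⁆ + R ⁅X, ⁅X, x⁆⁆ = 0) :
    IsCoisotropicSubalgebra (cobracket t) (LinearMap.range (sharp ⁅X, t⁆)) := by
  set a : L →ₗ[K] L := LieAlgebra.ad K L X with ha_def
  have ha (x y : L) : a ⁅x, y⁆ = ⁅a x, y⁆ + ⁅x, a y⁆ := leibniz_lie X x y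
  set D : L →ₗ[K] L := a ∘ₗ R - R ∘ₗ a with hD_def
  have hD (x : L) : D x = a (R x) - R (a x) := rfl
  have hE (x : L) : a (D x) = D (a x) := by
    have := hX x
    simp only [hD, map_sub]
    simp only [ha_def, LieAlgebra.ad_apply]
    linear_combination (norm := module) this
  have hsharp (x : L) : sharp ⁅X, t⁆ (B x) = D x := h.sharp_lie X x
  have hBD (x y : L) : B x (D y) = -B (D x) y := by
    have h1 (u v : L) : B u (a v) = -B (a u) v := h.apply_lie u X v
    simp only [hD, map_sub, h1, h.apply_apply, LinearMap.sub_apply]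
    abel
  have hker (x : L) : B x ∈ (LinearMap.range (sharp ⁅X, t⁆)).dualAnnihilator ↔ D x = 0 := by
    rw [Submodule.mem_dualAnnihilator]
    constructor
    · intro hx
      apply h.injective
      ext y
      have := hx (D y) ⟨B y, hsharp y⟩
      rw [hBD, neg_eq_zero] at this
      simpa using this
    · rintro hx _ ⟨η, rfl⟩
      obtain ⟨y, rfl⟩ := h.surjective η
      rw [hsharp, hBD, hx, map_zero, LinearMap.zero_apply, neg_zero]
  constructor
  · rintro _ ⟨ξ, rfl⟩ _ ⟨η, rfl⟩
    obtain ⟨x, rfl⟩ := h.surjective ξ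
    obtain ⟨y, rfl⟩ := h.surjective η
    rw [hsharp, hsharp, hR.lie_commutator ha hD hE, ← hsharp]
    exact ⟨_, rfl⟩
  · intro ξ hξ η hη
    obtain ⟨x, rfl⟩ := h.surjective ξ
    obtain ⟨y, rfl⟩ := h.surjective η
    rw [hker] at hξ hη
    rw [h.dualBracket, hker]
    have := hR.derivative ha hD x y
    rw [hξ, hη, zero_lie, lie_zero, zero_lie, lie_zero, add_zero, map_zero, sub_zero, zero_sub]
      at this
    rw [map_neg, this]

end Represents

end General

/-! ### The underlying real bivector -/

section Realification

variable {g : Type*} [LieRing g] [LieAlgebra ℂ g]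

theorem sharp_realBivector_rePart (t : g ⊗[ℂ] g) (ξ : Module.Dual ℂ g) :
    sharp (realBivector t) (rePart ξ) = sharp t ξ := by
  induction t with
  | zero => simp [sharp]
  | tmul x y =>
    have h (c : ℂ) : c • y = c.re • y + c.im • (Complex.I • y) := by
      conv_lhs => rw [← Complex.re_add_im c, add_smul, mul_smul]
      rfl
    simp [realBivector_tmul, sharp, rePart, h (ξ x)]
  | add s t hs ht => simp_all [sharp]

theorem comm_realBivector (t : g ⊗[ℂ] g) :
    TensorProduct.comm ℝ g g (realBivector t) = realBivector (TensorProduct.comm ℂ g g t) := by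
  induction t with
  | zero => simp
  | tmul x y => simp [realBivector_tmul]
  | add s t hs ht => simp_all

theorem rePart_surjective :
    Function.Surjective (rePart : Module.Dual ℂ g → Module.Dual ℝ g) := by
  intro φ
  refine ⟨Module.Dual.extendRCLike (𝕜 := ℂ) φ, ?_⟩
  ext x
  exact Module.Dual.re_extendRCLike_apply (𝕜 := ℂ) φ x

/-- The real part of a complex bilinear form. -/
def reForm (B : g →ₗ[ℂ] Module.Dual ℂ g) : g →ₗ[ℝ] Module.Dual ℝ g where
  toFun x := rePart (B x)
  map_add' x y := by ext z; simp [rePart]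
  map_smul' r x := by
    ext z
    simp [rePart]

/-- The same operator, now viewed as a real one, represents the real bivector with respect to
`Re B`. -/
theorem Represents.realBivector {B : g →ₗ[ℂ] Module.Dual ℂ g} {t : g ⊗[ℂ] g} {R : g →ₗ[ℂ] g}
    (h : Represents B t R) :
    Represents (reForm B) (realBivector t) (R.restrictScalars ℝ) where
  symm x y := congrArg Complex.re (h.symm x y)
  invariant x y z := congrArg Complex.re (h.invariant x y z)
  surjective := rePart_surjective.comp h.surjective
  skew := by rw [comm_realBivector, h.skew, map_neg]
  sharp_eq x := (sharp_realBivector_rePart t (B x)).trans (h.sharp_eq x)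

theorem ModifiedYangBaxter.restrictScalars {R : g →ₗ[ℂ] g} {c : ℝ}
    (hR : ModifiedYangBaxter R (c : ℂ)) : ModifiedYangBaxter (R.restrictScalars ℝ) c :=
  fun x y => hR x y

/-- The real and the complex bivector have the same contractions. -/
theorem Represents.range_sharp_lie_realBivector {B : g →ₗ[ℂ] Module.Dual ℂ g} {t : g ⊗[ℂ] g}
    {R : g →ₗ[ℂ] g} (h : Represents B t R) (X : g) :
    (LinearMap.range (sharp ⁅X, CoisotropicSubalgebras.realBivector t⁆) : Set g)
      = LinearMap.range (sharp ⁅X, t⁆) := by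
  rw [LinearMap.coe_range, LinearMap.coe_range, ← h.realBivector.surjective.range_comp,
    ← h.surjective.range_comp]
  congr 1
  ext x
  exact (h.realBivector.sharp_lie X x).trans (h.sharp_lie X x).symm

end Realification

/-! ### Root spaces and the Killing form -/

section Roots

open LieAlgebra LieModule

section RootSpaces

variable {g : Type*} [LieRing g] [LieAlgebra ℂ g] {H : LieSubalgebra ℂ g} [H.IsCartanSubalgebra]

theorem eq_zero_or_isRoot {χ : Module.Dual ℂ H} {x : g} (hx : x ∈ rootSpace H (χ : H → ℂ)) :
    x = 0 ∨ χ = 0 ∨ IsRoot H χ := by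
  by_cases hχ : χ = 0
  · exact .inr (.inl hχ)
  by_cases h : rootSpace H (χ : H → ℂ) = ⊥
  · left; simpa [h] using hx
  · exact .inr (.inr ⟨hχ, h⟩)

theorem lie_mem_rootSpace_add {χ ψ : Module.Dual ℂ H} {x y : g}
    (hx : x ∈ rootSpace H (χ : H → ℂ)) (hy : y ∈ rootSpace H (ψ : H → ℂ)) :
    ⁅x, y⁆ ∈ rootSpace H ((χ + ψ : Module.Dual ℂ H) : H → ℂ) :=
  lie_mem_genWeightSpace_of_mem_genWeightSpace hx hy

variable [FiniteDimensional ℂ g]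

/-- Elements of root spaces, including those in the Cartan subalgebra, span the Lie algebra. -/
theorem rootSpace_induction {p : g → Prop} (h0 : p 0) (hadd : ∀ x y, p x → p y → p (x + y))
    (hp : ∀ (χ : Module.Dual ℂ H), ∀ x ∈ rootSpace H (χ : H → ℂ), p x) (x : g) : p x := by
  have hx : x ∈ ⨆ χ : Weight ℂ H g, (rootSpace H χ).toSubmodule := by
    rw [← LieSubmodule.iSup_toSubmodule, iSup_genWeightSpace_eq_top' ℂ H g]
    trivial
  exact Submodule.iSup_induction (motive := p) _ hx (fun χ x hx => hp χ.toLinear x hx) h0 hadd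

theorem killingForm_eq_zero {χ ψ : Module.Dual ℂ H} (h : χ + ψ ≠ 0) {x y : g}
    (hx : x ∈ rootSpace H (χ : H → ℂ)) (hy : y ∈ rootSpace H (ψ : H → ℂ)) :
    killingForm ℂ g x y = 0 :=
  killingForm_apply_eq_zero_of_mem_rootSpace_of_add_ne_zero ℂ g H hx hy
    (fun h' => h (DFunLike.coe_injective h'))

variable [IsSemisimple ℂ g]

theorem IsRoot.neg {α : Module.Dual ℂ H} (hα : IsRoot H α) : IsRoot H (-α) :=
  ⟨neg_ne_zero.mpr hα.1, (-(⟨α, hα.2⟩ : Weight ℂ H g)).genWeightSpace_ne_bot⟩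

theorem lie_eq_zero_of_mem_rootSpace_zero {x y : g}
    (hx : x ∈ rootSpace H ((0 : Module.Dual ℂ H) : H → ℂ))
    (hy : y ∈ rootSpace H ((0 : Module.Dual ℂ H) : H → ℂ)) : ⁅x, y⁆ = 0 := by
  change x ∈ rootSpace H (0 : H → ℂ) at hx
  change y ∈ rootSpace H (0 : H → ℂ) at hy
  rw [rootSpace_zero_eq, LieSubalgebra.mem_toLieSubmodule] at hx hy
  exact congrArg Subtype.val (trivial_lie_zero H H ⟨x, hx⟩ ⟨y, hy⟩)

theorem exists_smul_eq_of_mem_rootSpace {α : Module.Dual ℂ H} (hα : IsRoot H α) {x y : g}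
    (hx : x ∈ rootSpace H (α : H → ℂ)) (hx0 : x ≠ 0) (hy : y ∈ rootSpace H (α : H → ℂ)) :
    ∃ c : ℂ, c • x = y := by
  have h1 := IsKilling.finrank_rootSpace_eq_one (⟨α, hα.2⟩ : Weight ℂ H g)
    (fun h => hα.1 (DFunLike.coe_injective h))
  obtain ⟨c, hc⟩ := (finrank_eq_one_iff_of_nonzero'
    (⟨x, hx⟩ : rootSpace H (α : H → ℂ)) (by simpa using hx0)).mp h1 ⟨y, hy⟩
  exact ⟨c, congrArg Subtype.val hc⟩

theorem killingForm_ne_zero {α : Module.Dual ℂ H} (hα : IsRoot H α) {x y : g}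
    (hx : x ∈ rootSpace H (α : H → ℂ)) (hx0 : x ≠ 0)
    (hy : y ∈ rootSpace H ((-α : Module.Dual ℂ H) : H → ℂ)) (hy0 : y ≠ 0) :
    killingForm ℂ g x y ≠ 0 := by
  intro h
  apply hx0
  have := mem_ker_killingForm_of_mem_rootSpace_of_forall_rootSpace_neg ℂ g H hx (fun z hz => by
    obtain ⟨c, rfl⟩ := exists_smul_eq_of_mem_rootSpace hα.neg hy hy0 hz
    rw [map_smul, h, smul_zero])
  simpa using this

theorem IsRoot.not_isRoot_add_self {β : Module.Dual ℂ H} (hβ : IsRoot H β) :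
    ¬ IsRoot H (β + β) := by
  refine fun h => h.2 ?_
  rw [← IsKilling.rootSpace_two_smul (⟨β, hβ.2⟩ : Weight ℂ H g)
    (fun h => hβ.1 (DFunLike.coe_injective h)), two_smul]
  rfl

end RootSpaces

/-! ### Signs of roots -/

section Sign

variable {g : Type*} [LieRing g] [LieAlgebra ℂ g] {H : LieSubalgebra ℂ g}

open Classical in
/-- The eigenvalue, on the root space of `χ`, of the operator represented by the standard
bivector: `-1` on positive roots, `1` on negative roots and `0` on the Cartan subalgebra; the
value is also `0` at functionals which are not roots. -/
def rootSign (P : Finset (Module.Dual ℂ H)) (χ : Module.Dual ℂ H) : ℂ :=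
  if χ ∈ P then -1 else if -χ ∈ P then 1 else 0

theorem rootSign_of_mem {P : Finset (Module.Dual ℂ H)} {χ : Module.Dual ℂ H} (h : χ ∈ P) :
    rootSign P χ = -1 := by
  simp [rootSign, h]

namespace IsPositiveSystem

variable [H.IsCartanSubalgebra] {P : Finset (Module.Dual ℂ H)} (hP : IsPositiveSystem H P)
include hP

theorem zero_notMem : (0 : Module.Dual ℂ H) ∉ P := fun h => (hP.isRoot _ h).1 rfl

theorem rootSign_of_neg_mem {χ : Module.Dual ℂ H} (h : -χ ∈ P) : rootSign P χ = 1 := by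
  have : χ ∉ P := fun h' => hP.neg_notMem _ h' h
  simp [rootSign, h, this]

theorem rootSign_zero : rootSign P 0 = 0 := by
  simp [rootSign, hP.zero_notMem]

theorem rootSign_neg (χ : Module.Dual ℂ H) : rootSign P (-χ) = -rootSign P χ := by
  by_cases h : χ ∈ P
  · rw [rootSign_of_mem h, hP.rootSign_of_neg_mem (by simpa using h), neg_neg]
  by_cases h' : -χ ∈ P
  · rw [rootSign_of_mem h', hP.rootSign_of_neg_mem h']
  · simp [rootSign, h, h']

theorem rootSign_mul_self {χ : Module.Dual ℂ H} (hχ : IsRoot H χ) :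
    rootSign P χ * rootSign P χ = 1 := by
  rcases hP.mem_or_neg_mem χ hχ with h | h
  · rw [rootSign_of_mem h]; norm_num
  · rw [hP.rootSign_of_neg_mem h]; norm_num

/-- The Yang-Baxter equation for the signs of two roots whose sum is a root or zero. -/
theorem rootSign_add {χ ψ : Module.Dual ℂ H} (hχ : IsRoot H χ) (hψ : IsRoot H ψ)
    (hadd : χ + ψ = 0 ∨ IsRoot H (χ + ψ)) (hneg : χ + ψ = 0 ∨ IsRoot H (-(χ + ψ))) :
    rootSign P χ * rootSign P ψ - rootSign P (χ + ψ) * (rootSign P χ + rootSign P ψ) = -1 := by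
  rcases hP.mem_or_neg_mem χ hχ with h | h <;> rcases hP.mem_or_neg_mem ψ hψ with h' | h'
  · have hmem : χ + ψ ∈ P := hP.add_mem _ h _ h' <| hadd.resolve_left fun h0 =>
      hP.neg_notMem χ h (neg_eq_of_add_eq_zero_right h0 ▸ h')
    rw [rootSign_of_mem h, rootSign_of_mem h', rootSign_of_mem hmem]; norm_num
  · rw [rootSign_of_mem h, hP.rootSign_of_neg_mem h']; norm_num
  · rw [hP.rootSign_of_neg_mem h, rootSign_of_mem h']; norm_num
  · have hmem : -(χ + ψ) ∈ P := by
      have h1 := hneg.resolve_left fun h0 =>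
        hP.neg_notMem (-χ) h (by rwa [neg_neg, eq_neg_of_add_eq_zero_left h0])
      rw [neg_add] at h1 ⊢
      exact hP.add_mem _ h _ h' h1
    rw [hP.rootSign_of_neg_mem h, hP.rootSign_of_neg_mem h', hP.rootSign_of_neg_mem hmem]
    norm_num

end IsPositiveSystem

end Sign

/-! ### The operator of the standard bivector -/

section StandardOperator

variable {g : Type*} [LieRing g] [LieAlgebra ℂ g] {H : LieSubalgebra ℂ g}

/-- The operator represented by the standard bivector with respect to the Killing form. -/
def standardOperator (P : Finset (Module.Dual ℂ H)) (e f : Module.Dual ℂ H → g) : g →ₗ[ℂ] g :=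
  sharp (standardBivector P e f) ∘ₗ killingForm ℂ g

theorem standardOperator_apply (P : Finset (Module.Dual ℂ H)) (e f : Module.Dual ℂ H → g) (x : g) :
    standardOperator P e f x = ∑ α ∈ P, (killingForm ℂ g (e α) (f α))⁻¹ •
      (killingForm ℂ g x (e α) • f α - killingForm ℂ g x (f α) • e α) := by
  simp [standardOperator, standardBivector, sharp, wedge]

variable [FiniteDimensional ℂ g] [IsSemisimple ℂ g]

theorem represents_standardOperator (P : Finset (Module.Dual ℂ H)) (e f : Module.Dual ℂ H → g) :
    Represents (killingForm ℂ g) (standardBivector P e f) (standardOperator P e f) where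
  symm := traceForm_comm ℂ g g
  invariant := traceForm_apply_lie_apply ℂ g g
  surjective := (LinearMap.injective_iff_surjective_of_finrank_eq_finrank
    (Subspace.dual_finrank_eq).symm).mp
      (LinearMap.ker_eq_bot.mp (IsKilling.ker_killingForm_eq_bot ℂ g))
  skew := by simp [standardBivector, wedge, ← Finset.sum_neg_distrib, ← smul_neg]
  sharp_eq _ := rfl

variable [H.IsCartanSubalgebra] {P : Finset (Module.Dual ℂ H)} (hP : IsPositiveSystem H P)
  {e f : Module.Dual ℂ H → g}
  (he : ∀ α ∈ P, e α ∈ rootSpace H (α : H → ℂ) ∧ e α ≠ 0)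
  (hf : ∀ α ∈ P, f α ∈ rootSpace H ((-α : Module.Dual ℂ H) : H → ℂ) ∧ f α ≠ 0)
include hP he hf

theorem standardOperator_eq_smul {χ : Module.Dual ℂ H} {x : g}
    (hx : x ∈ rootSpace H (χ : H → ℂ)) :
    standardOperator P e f x = rootSign P χ • x := by
  have hBe {α} (hα : α ∈ P) (h : α ≠ -χ) : killingForm ℂ g x (e α) = 0 :=
    killingForm_eq_zero (fun h0 => h (eq_neg_of_add_eq_zero_right h0)) hx (he α hα).1
  have hBf {α} (hα : α ∈ P) (h : α ≠ χ) : killingForm ℂ g x (f α) = 0 :=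
    killingForm_eq_zero (fun h0 => h (by simpa using (eq_neg_of_add_eq_zero_left h0).symm)) hx
      (hf α hα).1
  have hB {α} (hα : α ∈ P) : killingForm ℂ g (e α) (f α) ≠ 0 :=
    killingForm_ne_zero (hP.isRoot α hα) (he α hα).1 (he α hα).2 (hf α hα).1 (hf α hα).2
  rw [standardOperator_apply]
  rcases eq_zero_or_isRoot hx with rfl | rfl | hroot
  · simp
  · rw [hP.rootSign_zero, zero_smul]
    refine Finset.sum_eq_zero fun α hα => ?_
    have hα0 : α ≠ 0 := (hP.isRoot α hα).1
    rw [hBe hα (by simpa using hα0), hBf hα hα0]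
    simp
  rcases hP.mem_or_neg_mem χ hroot with h | h
  · have hne {α} (hα : α ∈ P) : α ≠ -χ := by
      rintro rfl
      exact hP.neg_notMem χ h hα
    rw [Finset.sum_eq_single_of_mem χ h
      (fun α hα hαχ => by rw [hBe hα (hne hα), hBf hα hαχ]; simp), hBe h (hne h)]
    obtain ⟨c, rfl⟩ := exists_smul_eq_of_mem_rootSpace hroot (he χ h).1 (he χ h).2 hx
    rw [rootSign_of_mem h, map_smul, LinearMap.smul_apply, zero_smul, zero_sub, smul_neg,
      smul_smul, smul_eq_mul, mul_comm c, inv_mul_cancel_left₀ (hB h), neg_one_smul]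
  · have hne {α} (hα : α ∈ P) : α ≠ χ := by
      rintro rfl
      exact hP.neg_notMem α hα h
    rw [Finset.sum_eq_single_of_mem (-χ) h
      (fun α hα hαχ => by rw [hBe hα hαχ, hBf hα (hne hα)]; simp), hBf h (hne h)]
    have hfχ := (hf (-χ) h).1
    rw [neg_neg] at hfχ
    obtain ⟨c, rfl⟩ := exists_smul_eq_of_mem_rootSpace hroot hfχ (hf (-χ) h).2 hx
    rw [hP.rootSign_of_neg_mem h, map_smul, LinearMap.smul_apply, zero_smul, sub_zero,
      (represents_standardOperator P e f).symm (f (-χ)),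
      smul_smul, smul_eq_mul, mul_comm c, inv_mul_cancel_left₀ (hB h), one_smul]

/-- On root spaces the equation is an identity between signs of roots. -/
theorem modifiedYangBaxter_standardOperator :
    ModifiedYangBaxter (standardOperator P e f) (-1 : ℂ) := by
  intro x y
  induction x using rootSpace_induction (H := H) with
  | h0 => simp
  | hadd x x' hx hx' =>
    simp only [map_add, add_lie, smul_add] at *
    linear_combination (norm := module) hx + hx'
  | hp χ x hx =>
  induction y using rootSpace_induction (H := H) with
  | h0 => simp
  | hadd y y' hy hy' =>
    simp only [map_add, lie_add, smul_add] at *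
    linear_combination (norm := module) hy + hy'
  | hp ψ y hy =>
  have hR {χ x} (hx : x ∈ rootSpace H ((χ : Module.Dual ℂ H) : H → ℂ)) :=
    standardOperator_eq_smul hP he hf hx
  have hxy := lie_mem_rootSpace_add hx hy
  suffices h : ⁅x, y⁆ = 0 ∨ rootSign P χ * rootSign P ψ
      - rootSign P (χ + ψ) * (rootSign P χ + rootSign P ψ) = -1 by
    simp only [hR hx, hR hy, smul_lie, lie_smul, map_add, map_smul, hR hxy]
    rcases h with h | h
    · simp [h]
    · rw [← h]; module
  rcases eq_zero_or_isRoot hx with rfl | rfl | hχ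
  · simp
  · rcases eq_zero_or_isRoot hy with rfl | rfl | hψ
    · simp
    · exact .inl (lie_eq_zero_of_mem_rootSpace_zero hx hy)
    · right
      rw [zero_add, hP.rootSign_zero]
      linear_combination -hP.rootSign_mul_self hψ
  · rcases eq_zero_or_isRoot hy with rfl | rfl | hψ
    · simp
    · right
      rw [add_zero, hP.rootSign_zero]
      linear_combination -hP.rootSign_mul_self hχ
    · exact (eq_zero_or_isRoot hxy).imp_right
        fun h => hP.rootSign_add hχ hψ h (h.imp_right IsRoot.neg)

/-- On the root space of `γ` the second commutator of `ad X` with the standard operator is a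
second difference of signs times `(ad X)²`. Either `(ad X)²` vanishes there, or `γ`, `γ + β`,
`γ + 2β` are roots or zero; then one of them vanishes because there are no three consecutive roots,
and it has to be `γ + β`, since `±2β` is not a root. -/
theorem second_commutator_standardOperator {β : Module.Dual ℂ H} (hβ : IsRoot H β)
    (hstring : ∀ γ, IsRoot H γ → IsRoot H (γ + β) → ¬ IsRoot H (γ + β + β))
    (h2β : ¬ IsRoot H (β + β)) {X : g} (hX : X ∈ rootSpace H (β : H → ℂ)) (x : g) :
    ⁅X, ⁅X, standardOperator P e f x⁆⁆ - (2 : ℂ) • ⁅X, standardOperator P e f ⁅X, x⁆⁆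
      + standardOperator P e f ⁅X, ⁅X, x⁆⁆ = 0 := by
  induction x using rootSpace_induction (H := H) with
  | h0 => simp
  | hadd x x' hx hx' =>
    simp only [map_add, lie_add, smul_add] at *
    linear_combination (norm := module) hx + hx'
  | hp γ x hx =>
  have hx1 := lie_mem_rootSpace_add hX hx
  have hx2 := lie_mem_rootSpace_add hX hx1
  rw [add_comm β γ] at hx1 hx2
  rw [add_comm β (γ + β)] at hx2
  rw [standardOperator_eq_smul hP he hf hx, standardOperator_eq_smul hP he hf hx1,
    standardOperator_eq_smul hP he hf hx2]
  suffices h : ⁅X, ⁅X, x⁆⁆ = 0 ∨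
      rootSign P γ - 2 * rootSign P (γ + β) + rootSign P (γ + β + β) = 0 by
    simp only [lie_smul]
    rcases h with h | h
    · simp [h]
    · rw [smul_smul, ← sub_smul, ← add_smul, h, zero_smul]
  rcases eq_zero_or_isRoot hx2 with h2 | h2 | h2
  · exact .inl h2
  · have hγ : γ = -(β + β) := by rw [eq_neg_iff_add_eq_zero, ← h2, add_assoc]
    rcases eq_zero_or_isRoot hx with rfl | h0 | h0
    · simp
    · refine absurd ?_ hβ.1
      rw [h0, zero_add, ← two_smul ℂ] at h2
      simpa using h2
    · exact absurd (by simpa [hγ] using h0.neg) h2β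
  rcases eq_zero_or_isRoot hx1 with h1 | h1 | h1
  · simp [h1]
  · right
    obtain rfl : γ = -β := eq_neg_of_add_eq_zero_left h1
    rw [h1, zero_add, hP.rootSign_neg, hP.rootSign_zero]
    ring
  rcases eq_zero_or_isRoot hx with rfl | rfl | h0
  · simp
  · exact absurd (by simpa using h2) h2β
  · exact absurd h2 (hstring γ h0 h1)

end StandardOperator

end Roots
end CoisotropicSubalgebras

end

open CoisotropicSubalgebras in
theorem corollary4p4 {g : Type*} [LieRing g] [LieAlgebra ℂ g] [FiniteDimensional ℂ g]
    [LieAlgebra.IsSemisimple ℂ g]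
    (H : LieSubalgebra ℂ g) [H.IsCartanSubalgebra]
    (P : Finset (Module.Dual ℂ H)) (hP : IsPositiveSystem H P)
    (e f : Module.Dual ℂ H → g)
    (he : ∀ α ∈ P, e α ∈ LieAlgebra.rootSpace H (α : H → ℂ) ∧ e α ≠ 0)
    (hf : ∀ α ∈ P, f α ∈ LieAlgebra.rootSpace H ((-α : Module.Dual ℂ H) : H → ℂ) ∧ f α ≠ 0)
    (β : Module.Dual ℂ H) (hβ : β ∈ P) (hstring : NoThreeString H β) :
    IsLieBialgebra (cobracket (standardBivector P e f)) ∧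
    IsLieBialgebra (cobracket (realBivector (standardBivector P e f))) ∧
    ∀ X : g, X = e β ∨ X = f β →
      IsCoisotropicSubalgebra (cobracket (realBivector (standardBivector P e f)))
        (LinearMap.range (sharp ⁅X, realBivector (standardBivector P e f)⁆)) ∧
      IsCoisotropicSubalgebra (cobracket (standardBivector P e f))
        (Submodule.span ℂ
          (LinearMap.range (sharp ⁅X, realBivector (standardBivector P e f)⁆) : Set g)) := by
  have hrep := represents_standardOperator P e f
  have hYB := modifiedYangBaxter_standardOperator hP he hf
  have hYB' : ModifiedYangBaxter ((standardOperator P e f).restrictScalars ℝ) (-1 : ℝ) :=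
    ModifiedYangBaxter.restrictScalars (by simpa using hYB)
  refine ⟨hrep.isLieBialgebra hYB, hrep.realBivector.isLieBialgebra hYB', fun X hX => ?_⟩
  have hβR := hP.isRoot β hβ
  have hE (x : g) : ⁅X, ⁅X, standardOperator P e f x⁆⁆
      - (2 : ℂ) • ⁅X, standardOperator P e f ⁅X, x⁆⁆ + standardOperator P e f ⁅X, ⁅X, x⁆⁆ = 0 := by
    rcases hX with rfl | rfl
    · refine second_commutator_standardOperator hP he hf hβR (fun γ h0 h1 h2 => ?_)
        hβR.not_isRoot_add_self (he β hβ).1 x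
      refine hstring γ h0 ⟨0, ?_, ?_, ?_⟩
      · simpa using h0
      · simpa using h1
      · simpa [two_smul, add_assoc] using h2
    · refine second_commutator_standardOperator hP he hf hβR.neg (fun γ h0 h1 h2 => ?_)
        hβR.neg.not_isRoot_add_self (hf β hβ).1 x
      refine hstring γ h0 ⟨-2, ?_, ?_, ?_⟩
      · simpa [two_smul, add_assoc] using h2
      · simpa using h1
      · simpa using h0
  constructor
  · refine hrep.realBivector.isCoisotropicSubalgebra hYB' X fun x => ?_
    simpa [two_smul] using hE x
  · rw [hrep.range_sharp_lie_realBivector, Submodule.span_eq]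
    exact hrep.isCoisotropicSubalgebra hYB X hE
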